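/- Fix a disruption probability $p\in(0,1)$ and a recovery parameter $\zeta\in[0,1]$. Let $\mathcal F$ be the set of cumulative distribution functions $F$ of finite-mean laws on $[0,\infty)$ that are continuous and strictly increasing on their support (i.e. where $0<F<1$). An instance is a pair $(n,F)$ with $n\ge1$ and $F\in\mathcal F$. Let $X_1,\dots,X_n$ be i.i.d. with distribution $F$, and let $Y_1,\dots,Y_n$ be i.i.d. Bernoulli($p$), independent of the $X_i$. A non-adaptive algorithm chooses for each instance one threshold $\tau=\tau(n,F)\in\mathbb R$. It observes $X_1,X_2,\dots$ in order and selects every $X_i\ge\tau$. If it selects $X_i$ and $Y_i=0$, it collects $X_i$ and continues; if $Y_i=1$, it collects $\zeta X_i$ and the process ends. Let $v(\mathtt{ALG}(n,F))$ be its expected total reward. The clairvoyant benchmark is $$v(\mathtt{OPT}(n,F))=\mathbb E\Big[\max_{\sigma}\Big\{\sum_{i=1}^{\min\{D-1,n\}}X_{\sigma(i)}+\zeta\,\mathbb 1\{D\le n\}\,X_{\sigma(D)}\Big\}\Big],$$ where $\sigma$ ranges over the permutations of $\{1,\dots,n\}$ and $D$ is independent of the $X_i$ with $\Pr[D=j]=p(1-p)^{j-1}$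 for $j\ge1$. Put $$\gamma_{n,p,\zeta}^{\mathrm{NA}}=\sup_{\mathtt{ALG}}\ \inf_{F\in\mathcal F}\frac{v(\mathtt{ALG}(n,F))}{v(\mathtt{OPT}(n,F))},\qquad \gamma_{p,\zeta}^{\mathrm{NA}}=\sup_{\mathtt{ALG}}\ \inf_{n\ge1,\,F\in\mathcal F}\frac{v(\mathtt{ALG}(n,F))}{v(\mathtt{OPT}(n,F))},$$ the suprema being over all non-adaptive algorithms. Then $$\gamma_{p,\zeta}^{\mathrm{NA}}=\inf_{n\ge1}\gamma_{n,p,\zeta}^{\mathrm{NA}}=1-\frac1e .$$ Moreover, for every instance $(n,F)$ there is a threshold $\tau$ with $1-F(\tau)=q_n:=\min\{1,1/(pn)\}$, and every such threshold satisfies $v(\mathtt{ALG}(n,F))/v(\mathtt{OPT}(n,F))\ge 1-1/e$; and $\gamma_{n,p,\zeta}^{\mathrm{NA}}\to 1-1/e$ as $n\to\infty$. -/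

import Mathlib

open MeasureTheory ProbabilityTheory
open scoped ENNReal

namespace OSUD

/-- The class of admissible value distributions: probability laws on the real line that are
supported in `[0, ∞)`, have a continuous cumulative distribution function `F` which is strictly
increasing on the support (that is, where `0 < F < 1`), and have a finite mean. -/
structure ValueLaw where
  law : Measure ℝ
  isProbabilityMeasure : IsProbabilityMeasure law
  nonneg : law (Set.Iio 0) = 0
  continuous_cdf : Continuous (cdf law)
  strictMonoOn_cdf : StrictMonoOn (cdf law) {x | 0 < cdf law x ∧ cdf law x < 1}
  integrable : Integrable (fun x : ℝ => x) law

open Classical in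
/-- Total reward collected along one realization, with values `x` in order of arrival and
disruption indicators `y`, by a decision maker who selects the `i`-th value when `sel i` holds.
The `i`-th value is collected if it is selected and no earlier selection caused a disruption; it
counts in full if selecting it causes no disruption, and with the factor `ζ` otherwise. -/
noncomputable def reward (ζ : ℝ) {n : ℕ} (x : Fin n → ℝ) (y : Fin n → Bool)
    (sel : Fin n → Prop) : ℝ :=
  ∑ i, if sel i ∧ ∀ j < i, ¬ (sel j ∧ y j = true) then
    (if y i = true then ζ * x i else x i) else 0

/-- Joint law of the i.i.d. values `X_i ∼ F` and, independent of them, the i.i.d. disruption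
indicators `Y_i ∼ Bernoulli(p)`. -/
noncomputable def jointLaw (p : unitInterval) (n : ℕ) (F : ValueLaw) :
    Measure ((Fin n → ℝ) × (Fin n → Bool)) :=
  (Measure.pi fun _ => F.law).prod (Measure.pi fun _ => bernoulliMeasure true false p)

/-- Expected reward of the non-adaptive algorithm that selects every observed value that is at
least the threshold `τ`, until a disruption occurs. -/
noncomputable def algValue (p ζ : unitInterval) (n : ℕ) (F : ValueLaw) (τ : ℝ) : ℝ≥0∞ :=
  ∫⁻ ω, ENNReal.ofReal (reward ζ ω.1 ω.2 fun i => τ ≤ ω.1 i) ∂jointLaw p n F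

/-- Reward of examining all the values in the order `σ` when exactly the first `k` selections
cause no disruption: the first `k` values in full (all of them if `n ≤ k`), and the fraction `ζ`
of the next one (if there is one). -/
noncomputable def orderedReward (ζ : ℝ) {n : ℕ} (x : Fin n → ℝ) (k : ℕ)
    (σ : Equiv.Perm (Fin n)) : ℝ :=
  ∑ i : Fin n, if (i : ℕ) < k then x (σ i) else if (i : ℕ) = k then ζ * x (σ i) else 0

/-- Expected reward of the optimal clairvoyant algorithm. The variable `k` is `D - 1`, where `D`
is the index of the first disruptive selection: `Pr[D - 1 = k] = (1 - p) ^ k * p`. -/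
noncomputable def optValue (p ζ : unitInterval) (n : ℕ) (F : ValueLaw) : ℝ≥0∞ :=
  ∫⁻ ω : (Fin n → ℝ) × ℕ, ⨆ σ : Equiv.Perm (Fin n),
    ENNReal.ofReal (orderedReward ζ ω.1 ω.2 σ)
    ∂(Measure.pi fun _ => F.law).prod (geometricMeasure p)

/-- Best worst-case ratio of non-adaptive algorithms on instances with `n` values. An algorithm
may choose its threshold depending on the distribution. -/
noncomputable def gammaNA_n (p ζ : unitInterval) (n : ℕ) : ℝ≥0∞ :=
  ⨆ τ : ValueLaw → ℝ, ⨅ F : ValueLaw, algValue p ζ n F (τ F) / optValue p ζ n F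

/-- Best worst-case ratio of non-adaptive algorithms over all instances `(n, F)` with `n ≥ 1`.
An algorithm chooses one fixed threshold for each instance. -/
noncomputable def gammaNA (p ζ : unitInterval) : ℝ≥0∞ :=
  ⨆ τ : ℕ → ValueLaw → ℝ, ⨅ (n : ℕ) (_ : 1 ≤ n) (F : ValueLaw),
    algValue p ζ n F (τ n F) / optValue p ζ n F

end OSUD

namespace OSUD

/-! Let c = 1 - p + pζ, q = P(X ≥ τ) and R = E[X; X ≥ τ]. Step i of a threshold rule is reached
without disruption with probability (1 - pq)^i, so the rule earns exactly c · ∑_{i<n} (1 - pq)^i · R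
(`algValue_eq`). The parameter ζ enters only through c; the same factor appears in the bounds on the
optimum and cancels.

Lower bound. The clairvoyant sorts the values decreasingly, and the i-th largest has mean weight c(1
- p)^i. Writing x ≤ (x - T)⁺ + T, with weights at most c on the excess and total weight at most c/p
on T, gives OPT ≤ c(n E(X - T)⁺ + T/p) (`optValue_le`). If nq = 1/p, then T = τ turns the right side
into c n R; if q = 1, T = 0 does. Since pq ≤ 1/n, the geometric sum is at least (1 - 1/e)n.

Tightness. Take a law with R(q) = bq + a q^ε, where ε = 1/n: a constant b plus a part carried by one
rare, huge value. With a = (pn)^(ε-1) and t = pnq, the threshold value is close to (c/p)(1 -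
e^(-t))(b + 1/t), while OPT tends to (c/p)(b + 1). The choice b = e - 2 makes t = 1 the maximizer,
with value (c/p)(1 - 1/e)(e - 1), so no threshold beats 1 - 1/e in the limit
(`one_sub_exp_neg_mul_le`, `algValue_hardLaw_le`, `le_optValue_hardLaw`). -/

/-! ### Exact value of a threshold rule -/

theorem lintegral_pi_prod {n : ℕ} {α : Type*} [MeasurableSpace α] (μ : Measure α)
    [IsProbabilityMeasure μ] (f : Fin n → α → ℝ≥0∞) (hf : ∀ i, Measurable (f i)) :
    ∫⁻ x, ∏ i, f i (x i) ∂Measure.pi (fun _ => μ) = ∏ i, ∫⁻ a, f i a ∂μ := by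
  refine (lintegral_prod_eq_prod_lintegral_of_indepFun Finset.univ
    (fun i (x : Fin n → α) => f i (x i)) (iIndepFun_pi fun i => (hf i).aemeasurable)
    fun i => (hf i).comp (measurable_pi_apply i)).trans ?_
  refine Finset.prod_congr rfl fun i _ => ?_
  exact (measurePreserving_eval (fun _ : Fin n => μ) i).lintegral_comp (hf i)

theorem prod_ite_lt_ite_eq {n : ℕ} (i : Fin n) (a b : ℝ≥0∞) :
    (∏ j : Fin n, if j < i then a else if j = i then b else 1) = a ^ (i : ℕ) * b := by
  have h : ∀ j : Fin n, (if j < i then a else if j = i then b else 1) =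
      (if j < i then a else 1) * (if j = i then b else 1) := by
    intro j
    rcases lt_trichotomy j i with h | h | h
    · simp [h, h.ne]
    · simp [h]
    · simp [h.not_gt, h.ne']
  simp_rw [h]
  rw [Finset.prod_mul_distrib, Finset.prod_ite_eq' Finset.univ i, if_pos (Finset.mem_univ _),
    Finset.prod_ite, Finset.prod_const, Finset.prod_const_one, mul_one]
  congr 2
  exact Fin.card_Iio i ▸ congrArg Finset.card (by ext; simp)

theorem lintegral_bernoulli (p : unitInterval) (f : Bool → ℝ≥0∞) :
    ∫⁻ y, f y ∂bernoulliMeasure true false p =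
      ENNReal.ofReal p * f true + ENNReal.ofReal (1 - p) * f false := by
  have h1 : ((unitInterval.toNNReal p : NNReal) : ℝ≥0∞) = ENNReal.ofReal p := by
    rw [← ENNReal.ofReal_coe_nnreal]; rfl
  have h2 : ((unitInterval.toNNReal (unitInterval.symm p) : NNReal) : ℝ≥0∞)
      = ENNReal.ofReal (1 - p) := by
    rw [← ENNReal.ofReal_coe_nnreal]; rfl
  rw [bernoulliMeasure_def, lintegral_add_measure, lintegral_smul_measure,
    lintegral_smul_measure, lintegral_dirac, lintegral_dirac, ← h1, ← h2]
  rfl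

instance (F : ValueLaw) : IsProbabilityMeasure F.law := F.isProbabilityMeasure

theorem ValueLaw.ae_nonneg (F : ValueLaw) : ∀ᵐ x ∂F.law, 0 ≤ x := by
  rw [ae_iff]
  simpa [Set.Iio, not_le] using F.nonneg

theorem ae_pi_forall {n : ℕ} (μ : Measure ℝ) [IsProbabilityMeasure μ] {P : ℝ → Prop}
    (h : ∀ᵐ x ∂μ, P x) : ∀ᵐ x ∂(Measure.pi fun _ : Fin n => μ), ∀ i, P (x i) :=
  Filter.eventually_all.2 fun i =>
    (measurePreserving_eval (fun _ : Fin n => μ) i).quasiMeasurePreserving.ae h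

/-- Mean weight `1 - p + p ζ` of a selected value. -/
noncomputable def meanWeight (p ζ : unitInterval) : ℝ := 1 - p + p * ζ

theorem meanWeight_nonneg (p ζ : unitInterval) : 0 ≤ meanWeight p ζ := by
  have := p.2.2
  have := mul_nonneg p.2.1 ζ.2.1
  unfold meanWeight
  linarith

theorem ofReal_meanWeight (p ζ : unitInterval) :
    ENNReal.ofReal (meanWeight p ζ) =
      ENNReal.ofReal p * ENNReal.ofReal ζ + ENNReal.ofReal (1 - p) := by
  rw [meanWeight, add_comm, ENNReal.ofReal_add (mul_nonneg p.2.1 ζ.2.1)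
    (sub_nonneg.2 p.2.2), ENNReal.ofReal_mul p.2.1]

theorem lintegral_ite_le (μ : Measure ℝ) (τ : ℝ) (f : ℝ → ℝ≥0∞) :
    ∫⁻ x, (if τ ≤ x then f x else 0) ∂μ = ∫⁻ x in Set.Ici τ, f x ∂μ := by
  rw [← lintegral_indicator measurableSet_Ici]
  rfl

theorem lintegral_ite_le_one (μ : Measure ℝ) [IsProbabilityMeasure μ] (p : unitInterval) (τ : ℝ) :
    ∫⁻ x, (if τ ≤ x then ENNReal.ofReal (1 - p) else 1) ∂μ =
      ENNReal.ofReal (1 - p * μ.real (Set.Ici τ)) := by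
  have hp := p.2.1
  have hp' := p.2.2
  have h : ∀ x : ℝ, (if τ ≤ x then ENNReal.ofReal (1 - p) else 1) =
      ENNReal.ofReal (1 - (Set.Ici τ).indicator (fun _ => (p : ℝ)) x) := by
    intro x
    by_cases hx : τ ≤ x <;> simp [hx]
  simp_rw [h]
  have hi : Integrable ((Set.Ici τ).indicator (fun _ => (p : ℝ))) μ :=
    (integrable_const _).indicator measurableSet_Ici
  rw [← ofReal_integral_eq_lintegral_ofReal
    (f := fun x => 1 - (Set.Ici τ).indicator (fun _ => (p : ℝ)) x) ((integrable_const _).sub hi)]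
  · rw [integral_sub (integrable_const _) hi, integral_indicator measurableSet_Ici]
    simp [mul_comm]
  · refine Filter.Eventually.of_forall fun x => ?_
    by_cases hx : τ ≤ x <;> simp [hx, hp']

theorem algValue_eq (p ζ : unitInterval) (n : ℕ) (F : ValueLaw) (τ : ℝ) :
    algValue p ζ n F τ = ENNReal.ofReal (meanWeight p ζ) *
      (∑ i : Fin n, ENNReal.ofReal (1 - p * F.law.real (Set.Ici τ)) ^ (i : ℕ)) *
        ∫⁻ x in Set.Ici τ, ENNReal.ofReal x ∂F.law := by
  -- The i-th summand of the reward factors over coordinates: no disruption at any j < i, the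
  -- weighted value at j = i, and 1 afterwards. Independence then integrates factor by factor.
  let f : Fin n → Fin n → ℝ → Bool → ℝ≥0∞ := fun i j x y =>
    if j < i then (if τ ≤ x ∧ y = true then 0 else 1) else if j = i then
      (if τ ≤ x then (if y = true then ENNReal.ofReal ζ else 1) * ENNReal.ofReal x else 0) else 1
  have hf : ∀ i j, Measurable fun a : ℝ × Bool => f i j a.1 a.2 := by
    intro i j
    refine measurable_from_prod_countable_left fun y => ?_
    dsimp only [f]
    split_ifs <;>
    first
    | fun_prop
    | exact Measurable.ite ((measurableSet_Ici (a := τ)).inter (MeasurableSet.const _))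
        (by fun_prop) (by fun_prop)
    | exact Measurable.ite (measurableSet_Ici (a := τ)) (by fun_prop) (by fun_prop)
  have hpt : ∀ᵐ ω ∂jointLaw p n F, ENNReal.ofReal (reward ζ ω.1 ω.2 fun i => τ ≤ ω.1 i) =
      ∑ i, ∏ j, f i j (ω.1 j) (ω.2 j) := by
    have h0 : ∀ᵐ ω ∂jointLaw p n F, ∀ i, 0 ≤ ω.1 i :=
      Measure.quasiMeasurePreserving_fst.ae (ae_pi_forall F.law F.ae_nonneg)
    filter_upwards [h0] with ω hω
    rw [reward, ENNReal.ofReal_sum_of_nonneg]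
    · refine Finset.sum_congr rfl fun i _ => ?_
      split_ifs with h hy
      · have : ∀ j, f i j (ω.1 j) (ω.2 j) = if j < i then 1 else if j = i then
          ENNReal.ofReal (ζ * ω.1 i) else 1 := by
          intro j
          dsimp only [f]
          split_ifs with h1 h2 h3 h4 h5
          · exact absurd h2 (h.2 j h1)
          all_goals simp_all [ENNReal.ofReal_mul ζ.2.1]
        simp_rw [this]
        rw [prod_ite_lt_ite_eq]
        simp
      · have : ∀ j, f i j (ω.1 j) (ω.2 j) = if j < i then 1 else if j = i then
          ENNReal.ofReal (ω.1 i) else 1 := by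
          intro j
          dsimp only [f]
          split_ifs with h1 h2 h3 h4 h5
          · exact absurd h2 (h.2 j h1)
          all_goals simp_all
        simp_rw [this]
        rw [prod_ite_lt_ite_eq]
        simp
      -- Nothing is collected at i: either an earlier selection disrupted, and its factor vanishes,
      -- or the i-th value misses the threshold, and the factor at i does.
      · rw [ENNReal.ofReal_zero, eq_comm, Finset.prod_eq_zero_iff]
        by_cases hi : τ ≤ ω.1 i
        · push Not at h
          obtain ⟨j, hj, hs⟩ := h hi
          exact ⟨j, Finset.mem_univ _, by simp [f, hj, hs]⟩
        · exact ⟨i, Finset.mem_univ _, by simp [f, hi]⟩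
    · intro i _
      split_ifs
      · exact mul_nonneg ζ.2.1 (hω i)
      · exact hω i
      · exact le_rfl
  have hm : ∀ i, Measurable fun ω : (Fin n → ℝ) × (Fin n → Bool) =>
      ∏ j, f i j (ω.1 j) (ω.2 j) := fun i =>
    Finset.measurable_prod _ fun j _ => (hf i j).comp
      (g := fun a : ℝ × Bool => f i j a.1 a.2)
      (f := fun ω : (Fin n → ℝ) × (Fin n → Bool) => (ω.1 j, ω.2 j)) (((measurable_pi_apply j).comp measurable_fst).prodMk
        ((measurable_pi_apply j).comp measurable_snd))
  have hterm : ∀ i, ∫⁻ ω, ∏ j, f i j (ω.1 j) (ω.2 j) ∂jointLaw p n F =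
      ENNReal.ofReal (1 - p * F.law.real (Set.Ici τ)) ^ (i : ℕ) *
        (ENNReal.ofReal (meanWeight p ζ) * ∫⁻ x in Set.Ici τ, ENNReal.ofReal x ∂F.law) := by
    intro i
    have hy : ∀ j x, ∫⁻ y, f i j x y ∂bernoulliMeasure true false p =
        if j < i then (if τ ≤ x then ENNReal.ofReal (1 - p) else 1) else if j = i then
          (if τ ≤ x then ENNReal.ofReal (meanWeight p ζ) * ENNReal.ofReal x else 0) else 1 := by
      intro j x
      have h1 : ENNReal.ofReal p + ENNReal.ofReal (1 - p) = 1 := by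
        rw [← ENNReal.ofReal_add p.2.1 (sub_nonneg.2 p.2.2)]; simp
      rw [lintegral_bernoulli]
      dsimp only [f]
      split_ifs <;> simp_all [ofReal_meanWeight]
      ring
    have hmy : ∀ j, Measurable fun x => ∫⁻ y, f i j x y ∂bernoulliMeasure true false p :=
      fun j => (hf i j).lintegral_prod_right'
    rw [jointLaw, lintegral_prod _ (hm i).aemeasurable]
    have h1 : ∀ x : Fin n → ℝ, ∫⁻ y, ∏ j, f i j (x j) (y j)
        ∂(Measure.pi fun _ : Fin n => bernoulliMeasure true false p) =
        ∏ j, ∫⁻ y, f i j (x j) y ∂bernoulliMeasure true false p := fun x =>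
      lintegral_pi_prod _ (fun j y => f i j (x j) y) fun j => measurable_of_countable _
    simp_rw [h1]
    rw [lintegral_pi_prod _ (fun j x => ∫⁻ y, f i j x y ∂bernoulliMeasure true false p) hmy,
      ← prod_ite_lt_ite_eq i]
    refine Finset.prod_congr rfl fun j _ => ?_
    simp_rw [hy]
    split_ifs
    · exact lintegral_ite_le_one _ _ _
    · rw [lintegral_ite_le, lintegral_const_mul _ (by fun_prop)]
    · simp
  rw [algValue, lintegral_congr_ae hpt, lintegral_finsetSum _ fun i _ => hm i]
  simp_rw [hterm]
  rw [← Finset.sum_mul]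
  ring

/-! ### Bounds on the clairvoyant optimum -/

/-- Factor with which the `i`-th examined value counts when exactly the first `k` selections cause
no disruption. -/
noncomputable def weight (ζ : ℝ) (k i : ℕ) : ℝ := if i < k then 1 else if i = k then ζ else 0

theorem weight_nonneg (ζ : unitInterval) (k i : ℕ) : 0 ≤ weight ζ k i := by
  have := ζ.2.1
  unfold weight
  split_ifs <;> simp [this]

theorem weight_antitone (ζ : unitInterval) (k : ℕ) : Antitone (weight ζ k) := by
  have h0 := ζ.2.1
  have h1 := ζ.2.2
  intro i j hij
  unfold weight
  split_ifs <;> first | omega | simp_all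

theorem orderedReward_eq (ζ : ℝ) {n : ℕ} (x : Fin n → ℝ) (k : ℕ) (σ : Equiv.Perm (Fin n)) :
    orderedReward ζ x k σ = ∑ i : Fin n, weight ζ k i * x (σ i) := by
  refine Finset.sum_congr rfl fun i _ => ?_
  unfold weight
  split_ifs <;> simp

theorem lintegral_weight {p : unitInterval} (hp : 0 < p) (ζ : unitInterval) (i : ℕ) :
    ∫⁻ k, ENNReal.ofReal (weight ζ k i) ∂geometricMeasure p =
      ENNReal.ofReal (meanWeight p ζ) * ENNReal.ofReal (1 - p) ^ i := by
  have hp1 : (0 : ℝ) ≤ 1 - p := sub_nonneg.2 p.2.2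
  have hsum : HasSum (fun k => (1 - p : ℝ) ^ k * p * weight ζ k i)
      (meanWeight p ζ * (1 - p) ^ i) := by
    -- Terms with k < i vanish, k = i contributes ζ, and the tail k > i has weight 1 and mass (1 -
    -- p)^(i + 1).
    rw [← hasSum_nat_add_iff' (i + 1)]
    have h := (hasSum_one_geometricMeasure hp.ne').mul_left ((1 - p : ℝ) ^ (i + 1))
    convert! h using 1
    · funext k
      have : weight ζ (k + (i + 1)) i = 1 := if_pos (by omega)
      rw [this]
      ring
    · rw [Finset.sum_range_succ, Finset.sum_eq_zero]
      · simp only [weight, lt_irrefl, if_true, if_false, meanWeight]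
        ring
      · intro k hk
        rw [Finset.mem_range] at hk
        simp [weight, hk.not_gt, hk.ne']
  rw [geometricMeasure_eq hp.ne', lintegral_sum_measure, ← ENNReal.ofReal_pow hp1,
    ← ENNReal.ofReal_mul (meanWeight_nonneg p ζ), ← hsum.tsum_eq, ENNReal.ofReal_tsum_of_nonneg
    (fun k => mul_nonneg (geometricMeasure_nonneg p k) (weight_nonneg ζ k i)) hsum.summable]
  refine tsum_congr fun k => ?_
  rw [lintegral_smul_measure, lintegral_dirac, smul_eq_mul,
    ENNReal.ofReal_mul (geometricMeasure_nonneg p k)]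

theorem sum_pow_le_inv (p : unitInterval) (n : ℕ) :
    ∑ i : Fin n, ENNReal.ofReal (1 - p) ^ (i : ℕ) ≤ (ENNReal.ofReal p)⁻¹ := by
  rw [Fin.sum_univ_eq_sum_range (fun i => ENNReal.ofReal (1 - p) ^ i) n]
  refine (ENNReal.sum_le_tsum _).trans_eq ?_
  rw [ENNReal.tsum_geometric, ← ENNReal.ofReal_one, ← ENNReal.ofReal_sub _ (sub_nonneg.2 p.2.2)]
  simp

/-- By the rearrangement inequality, decreasing order is optimal because the weights decrease. The
same order serves every k, so the weights can afterwards be averaged over k for fixed x. -/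
theorem iSup_orderedReward_le (ζ : unitInterval) {n : ℕ} (x : Fin n → ℝ) (T : ℝ) (hT : 0 ≤ T) :
    ∃ σ₀ : Equiv.Perm (Fin n), ∀ k, (⨆ σ, ENNReal.ofReal (orderedReward ζ x k σ)) ≤
      ∑ i : Fin n, ENNReal.ofReal (weight ζ k i) *
        (ENNReal.ofReal (x (σ₀ i) - T) + ENNReal.ofReal T) := by
  refine ⟨Tuple.sort fun i => -x i, fun k => iSup_le fun σ => ?_⟩
  set σ₀ := Tuple.sort fun i => -x i
  have hanti : Antitone fun i => x (σ₀ i) := fun i j hij => by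
    have := Tuple.monotone_sort (fun i => -x i) hij
    simpa using this
  have hmono : Monovary (fun i : Fin n => weight ζ k i) fun i => x (σ₀ i) :=
    Antitone.monovary (fun i j hij => weight_antitone ζ k hij) hanti
  have h1 : orderedReward ζ x k σ ≤ ∑ i : Fin n, weight ζ k i * x (σ₀ i) := by
    have := hmono.sum_mul_comp_perm_le_sum_mul (σ := σ.trans σ₀.symm)
    rw [orderedReward_eq]
    simpa using this
  refine (ENNReal.ofReal_le_ofReal h1).trans ?_
  refine (ENNReal.ofReal_le_ofReal (Finset.sum_le_sum fun i _ => ?_)).trans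
    (ENNReal.ofReal_sum_of_nonneg
      (f := fun i : Fin n => weight ζ k i * (max (x (σ₀ i) - T) 0 + T)) fun i _ => ?_).le |>.trans ?_
  · refine mul_le_mul_of_nonneg_left ?_ (weight_nonneg ζ k i)
    linarith [le_max_left (x (σ₀ i) - T) 0]
  · exact mul_nonneg (weight_nonneg ζ k i) (add_nonneg (le_max_right _ _) hT)
  · refine Finset.sum_le_sum fun i _ => le_of_eq ?_
    rw [ENNReal.ofReal_mul (weight_nonneg ζ k i), ENNReal.ofReal_add (le_max_right _ _) hT]
    congr 2
    rcases le_total (x (σ₀ i) - T) 0 with h | h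
    · simp [h]
    · rw [max_eq_left h]

theorem optValue_le {p : unitInterval} (hp : 0 < p) (ζ : unitInterval) (n : ℕ) (F : ValueLaw)
    (T : ℝ) (hT : 0 ≤ T) :
    optValue p ζ n F ≤ ENNReal.ofReal (meanWeight p ζ) *
      (n * ∫⁻ x, ENNReal.ofReal (x - T) ∂F.law + ENNReal.ofReal T * (ENNReal.ofReal p)⁻¹) := by
  have hp1 : ENNReal.ofReal (1 - p) ≤ 1 := by
    rw [ENNReal.ofReal_le_one]; linarith [p.2.1]
  have hx : ∀ x : Fin n → ℝ, ∫⁻ k, ⨆ σ, ENNReal.ofReal (orderedReward ζ x k σ)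
      ∂geometricMeasure p ≤ ENNReal.ofReal (meanWeight p ζ) *
        (∑ i, ENNReal.ofReal (x i - T) + ENNReal.ofReal T * (ENNReal.ofReal p)⁻¹) := by
    intro x
    obtain ⟨σ₀, h⟩ := iSup_orderedReward_le ζ x T hT
    refine (lintegral_mono h).trans ?_
    rw [lintegral_finsetSum _ fun i _ => measurable_of_countable _]
    simp_rw [lintegral_mul_const _ (measurable_of_countable _), lintegral_weight hp ζ, mul_add,
      Finset.sum_add_distrib, mul_assoc]
    rw [← Finset.mul_sum, ← Finset.mul_sum, ← Finset.sum_mul]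
    refine add_le_add (mul_le_mul_right ?_ _) (mul_le_mul_right ?_ _)
    · calc ∑ i : Fin n, ENNReal.ofReal (1 - p) ^ (i : ℕ) * ENNReal.ofReal (x (σ₀ i) - T)
          ≤ ∑ i : Fin n, ENNReal.ofReal (x (σ₀ i) - T) :=
            Finset.sum_le_sum fun i _ => mul_le_of_le_one_left' (pow_le_one' hp1 _)
        _ = ∑ i, ENNReal.ofReal (x i - T) :=
            Equiv.sum_comp σ₀ fun i => ENNReal.ofReal (x i - T)
    · rw [mul_comm]
      refine mul_le_mul_right ?_ _
      exact sum_pow_le_inv p n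
  have hev : ∀ i : Fin n, ∫⁻ x, ENNReal.ofReal (x i - T) ∂(Measure.pi fun _ : Fin n => F.law) =
      ∫⁻ x, ENNReal.ofReal (x - T) ∂F.law := fun i =>
    (measurePreserving_eval (fun _ : Fin n => F.law) i).lintegral_comp
      (f := fun x => ENNReal.ofReal (x - T)) (by fun_prop)
  -- This direction of Tonelli needs no measurability of the supremum over orders.
  refine (lintegral_prod_le _).trans ((lintegral_mono hx).trans_eq ?_)
  rw [lintegral_const_mul _ (by fun_prop), lintegral_add_right _ measurable_const,
    lintegral_finsetSum _ fun i _ => by fun_prop]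
  simp [hev]

theorem le_iSup_orderedReward (ζ : unitInterval) {n : ℕ} [NeZero n] (x : Fin n → ℝ) (k : ℕ) (b : ℝ)
    (hb : 0 ≤ b) (hx : ∀ i, b ≤ x i) (m : Fin n) :
    ENNReal.ofReal b * ∑ i : Fin n, ENNReal.ofReal (weight ζ k i) +
      ENNReal.ofReal (weight ζ k 0) * ENNReal.ofReal (x m - b) ≤
        ⨆ σ, ENNReal.ofReal (orderedReward ζ x k σ) := by
  refine le_iSup_of_le (Equiv.swap 0 m) ?_
  rw [← ENNReal.ofReal_sum_of_nonneg fun (i : Fin n) _ => weight_nonneg ζ k i, ← ENNReal.ofReal_mul hb,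
    ← ENNReal.ofReal_mul (weight_nonneg ζ k 0), ← ENNReal.ofReal_add
    (mul_nonneg hb (Finset.sum_nonneg fun (i : Fin n) _ => weight_nonneg ζ k i))
    (mul_nonneg (weight_nonneg ζ k 0) (sub_nonneg.2 (hx m))), orderedReward_eq]
  refine ENNReal.ofReal_le_ofReal ?_
  have h : ∑ i : Fin n, weight ζ k i * x (Equiv.swap 0 m i) =
      b * ∑ i : Fin n, weight ζ k i + ∑ i : Fin n, weight ζ k i * (x (Equiv.swap 0 m i) - b) := by
    rw [Finset.mul_sum, ← Finset.sum_add_distrib]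
    exact Finset.sum_congr rfl fun i _ => by ring
  rw [h]
  have := Finset.single_le_sum (f := fun i : Fin n => weight ζ k i * (x (Equiv.swap 0 m i) - b))
    (fun i _ => mul_nonneg (weight_nonneg ζ k i) (sub_nonneg.2 (hx _))) (Finset.mem_univ 0)
  simpa using this

/-- Every value contributes at least b in any order. When exactly one value reaches T, examining it
first adds its excess over b with mean weight c = `meanWeight p ζ`. These events are disjoint for
the n positions, hence the factor n. -/
theorem le_optValue {p : unitInterval} (hp : 0 < p) (ζ : unitInterval) (n : ℕ) (hn : 1 ≤ n)
    (F : ValueLaw) (b T : ℝ) (hb : 0 ≤ b) (hF : ∀ᵐ x ∂F.law, b ≤ x) :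
    ENNReal.ofReal (meanWeight p ζ) *
      (ENNReal.ofReal b * ∑ i : Fin n, ENNReal.ofReal (1 - p) ^ (i : ℕ) +
        n * ((∫⁻ x in Set.Ici T, ENNReal.ofReal (x - b) ∂F.law) * F.law (Set.Iio T) ^ (n - 1))) ≤
      optValue p ζ n F := by
  have : NeZero n := ⟨by omega⟩
  -- The product over j is the excess of the m-th value over b on the event that it alone reaches T,
  -- and 0 elsewhere.
  let f : Fin n → Fin n → ℝ → ℝ≥0∞ := fun m j x =>
    if j = m then (if T ≤ x then ENNReal.ofReal (x - b) else 0) else (Set.Iio T).indicator 1 x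
  have hf : ∀ m j, Measurable (f m j) := fun m j => by
    dsimp only [f]
    split_ifs
    · exact Measurable.ite (measurableSet_Ici (a := T)) (by fun_prop) (by fun_prop)
    · exact measurable_one.indicator measurableSet_Iio
  have hm : ∀ m, Measurable fun x : Fin n → ℝ => ∏ j, f m j (x j) := fun m =>
    Finset.measurable_prod _ fun j _ => (hf m j).comp (measurable_pi_apply j)
  have hle : ∀ x : Fin n → ℝ, ∃ m, ∑ m, ∏ j, f m j (x j) ≤ ENNReal.ofReal (x m - b) := by
    intro x
    have hne : ∀ m, (∏ j, f m j (x j)) ≠ 0 → T ≤ x m ∧ ∀ j ≠ m, x j < T := by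
      intro m hm
      have h := fun j => Finset.prod_ne_zero_iff.1 hm j (Finset.mem_univ j)
      constructor
      · have := h m
        by_contra h'
        simp [f, h'] at this
      · intro j hj
        have := h j
        by_contra h'
        simp [f, hj, h'] at this
    by_cases h : ∃ m, (∏ j, f m j (x j)) ≠ 0
    · obtain ⟨m, hm⟩ := h
      refine ⟨m, ?_⟩
      rw [Finset.sum_eq_single m]
      · have hT := hne m hm
        rw [Finset.prod_eq_single m]
        · simp [f, hT.1]
        · intro j _ hj
          simp [f, hj, hT.2 j hj]
        · simp
      · intro m' _ hm'
        by_contra h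
        exact absurd ((hne m hm).1) (not_le.2 ((hne m' h).2 m hm'.symm))
      · simp
    · push Not at h
      exact ⟨0, by simp [h]⟩
  have hint : ∀ m, ∫⁻ x, ∏ j, f m j (x j) ∂(Measure.pi fun _ : Fin n => F.law) =
      (∫⁻ x in Set.Ici T, ENNReal.ofReal (x - b) ∂F.law) * F.law (Set.Iio T) ^ (n - 1) := by
    intro m
    rw [lintegral_pi_prod _ _ (hf m), ← Finset.mul_prod_erase _ _ (Finset.mem_univ m)]
    congr 1
    · simp only [f, if_true]
      exact lintegral_ite_le _ _ _
    · rw [Finset.prod_congr rfl (g := fun _ => F.law (Set.Iio T)), Finset.prod_const]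
      · simp
      · intro j hj
        simp only [f, if_neg (Finset.ne_of_mem_erase hj)]
        exact lintegral_indicator_one measurableSet_Iio
  have hae : ∀ᵐ ω ∂(Measure.pi fun _ : Fin n => F.law).prod (geometricMeasure p),
      ENNReal.ofReal b * ∑ i : Fin n, ENNReal.ofReal (weight ζ ω.2 i) +
        ENNReal.ofReal (weight ζ ω.2 0) * ∑ m, ∏ j, f m j (ω.1 j) ≤
          ⨆ σ, ENNReal.ofReal (orderedReward ζ ω.1 ω.2 σ) := by
    filter_upwards [Measure.quasiMeasurePreserving_fst.ae (ae_pi_forall F.law hF)] with ω hω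
    obtain ⟨m, hm⟩ := hle ω.1
    refine le_trans ?_ (le_iSup_orderedReward ζ ω.1 ω.2 b hb hω m)
    gcongr
  refine le_trans (le_of_eq ?_) (lintegral_mono_ae hae)
  have hw : ∀ i : ℕ, Measurable fun k => ENNReal.ofReal (weight ζ k i) := fun i =>
    measurable_of_countable _
  have hmsum : Measurable fun x : Fin n → ℝ => ∑ m, ∏ j, f m j (x j) :=
    Finset.measurable_sum _ fun m _ => hm m
  have hwsum : Measurable fun k => ENNReal.ofReal b * ∑ i : Fin n, ENNReal.ofReal (weight ζ k i) :=
    measurable_of_countable _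
  have h1 : ∫⁻ ω, ENNReal.ofReal b * ∑ i : Fin n, ENNReal.ofReal (weight ζ ω.2 i)
      ∂(Measure.pi fun _ : Fin n => F.law).prod (geometricMeasure p) =
      ENNReal.ofReal (meanWeight p ζ) *
        (ENNReal.ofReal b * ∑ i : Fin n, ENNReal.ofReal (1 - p) ^ (i : ℕ)) := by
    have := lintegral_prod_mul (μ := Measure.pi fun _ : Fin n => F.law) (ν := geometricMeasure p)
      (f := fun _ => 1) measurable_const.aemeasurable hwsum.aemeasurable
    simp only [one_mul, lintegral_one, measure_univ] at this
    rw [this, lintegral_const_mul _ (measurable_of_countable _),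
      lintegral_finsetSum _ fun (i : Fin n) _ => hw i]
    simp_rw [lintegral_weight hp ζ]
    rw [← Finset.mul_sum]
    ring
  have h2 : ∫⁻ ω, ENNReal.ofReal (weight ζ ω.2 0) * ∑ m, ∏ j, f m j (ω.1 j)
      ∂(Measure.pi fun _ : Fin n => F.law).prod (geometricMeasure p) =
      ENNReal.ofReal (meanWeight p ζ) * (n * ((∫⁻ x in Set.Ici T, ENNReal.ofReal (x - b) ∂F.law) *
        F.law (Set.Iio T) ^ (n - 1))) := by
    have := lintegral_prod_mul (μ := Measure.pi fun _ : Fin n => F.law) (ν := geometricMeasure p)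
      hmsum.aemeasurable (hw 0).aemeasurable
    simp_rw [mul_comm (ENNReal.ofReal (weight _ _ _))]
    rw [this, lintegral_finsetSum _ fun m _ => hm m, lintegral_weight hp ζ]
    simp [hint, mul_comm]
  rw [lintegral_add_left (f := fun ω : (Fin n → ℝ) × ℕ =>
    ENNReal.ofReal b * ∑ i : Fin n, ENNReal.ofReal (weight ζ ω.2 i))
    (hwsum.comp measurable_snd), h1, h2, mul_add]

/-! ### The guarantee of the quantile threshold -/

theorem le_sum_pow_of_le {n : ℕ} (hn : 1 ≤ n) {r : ℝ} (hr : 1 - 1 / (n : ℝ) ≤ r) :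
    (1 - 1 / Real.exp 1) * n ≤ ∑ i ∈ Finset.range n, r ^ i := by
  have hn0 : (0 : ℝ) < n := by exact_mod_cast hn
  have hn1 : (1 : ℝ) ≤ n := by exact_mod_cast hn
  have h0 : 0 ≤ 1 - 1 / (n : ℝ) := by rw [sub_nonneg, div_le_one hn0]; exact hn1
  have hexp : (1 - 1 / (n : ℝ)) ^ n ≤ 1 / Real.exp 1 := by
    have := Real.one_sub_div_pow_le_exp_neg (n := n) (t := 1) hn1
    rwa [Real.exp_neg, ← one_div] at this
  have hgeom : ∑ i ∈ Finset.range n, (1 - 1 / (n : ℝ)) ^ i = (1 - (1 - 1 / (n : ℝ)) ^ n) * n := by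
    rw [geom_sum_eq (by simp [hn0.ne'])]
    field_simp
    ring
  calc (1 - 1 / Real.exp 1) * n ≤ (1 - (1 - 1 / (n : ℝ)) ^ n) * n := by gcongr
    _ = ∑ i ∈ Finset.range n, (1 - 1 / (n : ℝ)) ^ i := hgeom.symm
    _ ≤ _ := Finset.sum_le_sum fun i _ => by gcongr

theorem ValueLaw.measure_singleton (F : ValueLaw) (x : ℝ) : F.law {x} = 0 := by
  rw [← measure_cdf F.law, StieltjesFunction.measure_singleton,
    leftLim_eq_of_tendsto (F.continuous_cdf.tendsto x |>.mono_left
      nhdsWithin_le_nhds)]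
  simp

theorem ValueLaw.real_Ici (F : ValueLaw) (τ : ℝ) : F.law.real (Set.Ici τ) = 1 - cdf F.law τ := by
  have h : F.law.real (Set.Iic τ) = F.law.real (Set.Iio τ) := by
    rw [← Set.Iio_union_right, measureReal_union (by simp) (measurableSet_singleton τ)]
    simp [measureReal_def, F.measure_singleton]
  rw [cdf_eq_real, h, ← probReal_compl_eq_one_sub measurableSet_Iio, Set.compl_Iio]

theorem ValueLaw.cdf_eq_zero (F : ValueLaw) {x : ℝ} (hx : x < 0) : cdf F.law x = 0 := by
  rw [cdf_eq_real, measureReal_def, measure_mono_null (t := Set.Iio 0) _ F.nonneg]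
  · simp
  · exact fun y hy => lt_of_le_of_lt hy hx

theorem ValueLaw.exists_quantile (F : ValueLaw) {q : ℝ} (h0 : 0 < q) (h1 : q ≤ 1) :
    ∃ τ, 1 - cdf F.law τ = q := by
  obtain ⟨b, hb⟩ := ((tendsto_cdf_atTop F.law).eventually_const_le
    (sub_lt_self 1 h0)).exists
  obtain ⟨τ, hτ⟩ := mem_range_of_exists_le_of_exists_ge F.continuous_cdf
    ⟨-1, by rw [F.cdf_eq_zero (by norm_num)]; linarith⟩ ⟨b, hb⟩
  exact ⟨τ, by rw [hτ]; ring⟩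

theorem meanWeight_pos {p : unitInterval} (hp : p < 1) (ζ : unitInterval) :
    0 < meanWeight p ζ := by
  have h : (p : ℝ) < 1 := hp
  have := mul_nonneg p.2.1 ζ.2.1
  unfold meanWeight
  linarith

/-- A continuous distribution function excludes an atom at 0, so a tail of positive mass has
positive mass on (0, ∞). -/
theorem ValueLaw.setLIntegral_ne_zero (F : ValueLaw) {τ : ℝ} (h : 0 < F.law.real (Set.Ici τ)) :
    ∫⁻ x in Set.Ici τ, ENNReal.ofReal x ∂F.law ≠ 0 := by
  have h' : F.law (Set.Ici τ ∩ Set.Ioi 0) ≠ 0 := by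
    intro h0
    have hle : Set.Ici τ ⊆ (Set.Ici τ ∩ Set.Ioi 0) ∪ (Set.Iio 0 ∪ {0}) := by
      intro x hx
      rcases lt_trichotomy x 0 with h | h | h <;> simp_all [lt_or_ge]
    have := measure_mono_null hle (measure_union_null h0
      (measure_union_null F.nonneg (F.measure_singleton 0)))
    simp [measureReal_def, this] at h
  intro h0
  rw [lintegral_eq_zero_iff (by fun_prop), Filter.EventuallyEq, ae_restrict_iff'
    measurableSet_Ici, ae_iff] at h0
  refine h' (measure_mono_null (fun x hx => ?_) h0)
  have h1 : τ ≤ x := hx.1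
  have h2 : 0 < x := hx.2
  simp [h1, h2]

theorem ValueLaw.setLIntegral_ne_top (F : ValueLaw) (τ : ℝ) :
    ∫⁻ x in Set.Ici τ, ENNReal.ofReal x ∂F.law ≠ ⊤ :=
  ne_top_of_le_ne_top F.integrable.lintegral_lt_top.ne (setLIntegral_le_lintegral _ _)

theorem ValueLaw.lintegral_split (F : ValueLaw) {τ : ℝ} (hτ : 0 ≤ τ) :
    ∫⁻ x in Set.Ici τ, ENNReal.ofReal x ∂F.law =
      ∫⁻ x, ENNReal.ofReal (x - τ) ∂F.law + ENNReal.ofReal τ * F.law (Set.Ici τ) := by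
  have h : ∫⁻ x, ENNReal.ofReal (x - τ) ∂F.law =
      ∫⁻ x in Set.Ici τ, ENNReal.ofReal (x - τ) ∂F.law := by
    rw [← lintegral_indicator measurableSet_Ici]
    refine lintegral_congr fun x => ?_
    by_cases hx : τ ≤ x
    · simp [hx]
    · simp [hx, (not_le.1 hx).le]
  rw [h, ← setLIntegral_const, ← lintegral_add_right _ measurable_const]
  refine setLIntegral_congr_fun measurableSet_Ici fun x hx => ?_
  have hx : τ ≤ x := hx
  rw [← ENNReal.ofReal_add (sub_nonneg.2 hx) hτ, sub_add_cancel]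

theorem ValueLaw.setLIntegral_of_cdf_eq_zero (F : ValueLaw) {τ : ℝ} (h : cdf F.law τ = 0) :
    ∫⁻ x in Set.Ici τ, ENNReal.ofReal x ∂F.law = ∫⁻ x, ENNReal.ofReal (x - 0) ∂F.law := by
  have h0 : F.law (Set.Ici τ)ᶜ = 0 := by
    rw [Set.compl_Ici]
    refine measure_mono_null Set.Iio_subset_Iic_self ?_
    rw [← ofReal_cdf, h, ENNReal.ofReal_zero]
  rw [Measure.restrict_eq_self_of_ae_mem (s := Set.Ici τ) (by rw [ae_iff]; exact h0)]
  simp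

theorem optValue_le_of_quantile {p : unitInterval} (hp : 0 < p) (ζ : unitInterval) {n : ℕ}
    (hn : 1 ≤ n) (F : ValueLaw) {τ : ℝ} (hτ : 1 - cdf F.law τ = min 1 (1 / ((p : ℝ) * n))) :
    optValue p ζ n F ≤ ENNReal.ofReal (meanWeight p ζ) *
      (n * ∫⁻ x in Set.Ici τ, ENNReal.ofReal x ∂F.law) := by
  have hp' : (0 : ℝ) < p := hp
  have hn0 : (0 : ℝ) < n := by exact_mod_cast hn
  -- If the tail probability is 1, τ may be negative, so the optimum is bounded with T = 0.
  -- Otherwise τ ≥ 0 and n P(X ≥ τ) = 1/p exactly, so T = τ works.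
  rcases eq_or_ne (cdf F.law τ) 0 with h0 | h0
  · rw [F.setLIntegral_of_cdf_eq_zero h0]
    simpa using optValue_le hp ζ n F 0 le_rfl
  · have hτ0 : 0 ≤ τ := by
      by_contra h
      exact h0 (F.cdf_eq_zero (not_le.1 h))
    have hq : 1 - cdf F.law τ = 1 / ((p : ℝ) * n) := by
      rcases min_choice 1 (1 / ((p : ℝ) * n)) with h | h
      · exact absurd (by linarith) h0
      · rw [hτ, h]
    rw [F.lintegral_split hτ0]
    refine (optValue_le hp ζ n F τ hτ0).trans (le_of_eq ?_)
    have hμ : F.law (Set.Ici τ) = ENNReal.ofReal (1 / ((p : ℝ) * n)) := by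
      rw [← hq, ← F.real_Ici, ofReal_measureReal]
    have : (n : ℝ≥0∞) * F.law (Set.Ici τ) = (ENNReal.ofReal p)⁻¹ := by
      rw [hμ, ← ENNReal.ofReal_natCast, ← ENNReal.ofReal_mul hn0.le, ← ENNReal.ofReal_inv_of_pos hp']
      congr 1
      field_simp
    rw [mul_add, ← this]
    ring

theorem le_ratio_of_quantile {p : unitInterval} (hp0 : 0 < p) (hp1 : p < 1) (ζ : unitInterval)
    {n : ℕ} (hn : 1 ≤ n) (F : ValueLaw) {τ : ℝ}
    (hτ : 1 - cdf F.law τ = min 1 (1 / ((p : ℝ) * n))) :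
    ENNReal.ofReal (1 - 1 / Real.exp 1) ≤ algValue p ζ n F τ / optValue p ζ n F := by
  have hp' : (0 : ℝ) < p := hp0
  have hp1' : (p : ℝ) < 1 := hp1
  have hn0 : (0 : ℝ) < n := by exact_mod_cast hn
  have hq0 : 0 < F.law.real (Set.Ici τ) := by rw [F.real_Ici, hτ]; positivity
  have hpq : (p : ℝ) * F.law.real (Set.Ici τ) ≤ 1 / n := by
    rw [F.real_Ici, hτ]
    calc (p : ℝ) * min 1 (1 / ((p : ℝ) * n)) ≤ p * (1 / ((p : ℝ) * n)) := by
          gcongr; exact min_le_right _ _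
      _ = 1 / n := by field_simp
  have hr0 : 0 ≤ 1 - (p : ℝ) * F.law.real (Set.Ici τ) := by
    have : (p : ℝ) * F.law.real (Set.Ici τ) ≤ 1 * 1 :=
      mul_le_mul hp1'.le measureReal_le_one measureReal_nonneg zero_le_one
    linarith
  have hsum : ENNReal.ofReal (1 - 1 / Real.exp 1) * n ≤
      ∑ i : Fin n, ENNReal.ofReal (1 - p * F.law.real (Set.Ici τ)) ^ (i : ℕ) := by
    rw [Fin.sum_univ_eq_sum_range
      (fun i => ENNReal.ofReal (1 - p * F.law.real (Set.Ici τ)) ^ i) n]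
    simp_rw [← ENNReal.ofReal_pow hr0]
    rw [← ENNReal.ofReal_sum_of_nonneg fun i _ => pow_nonneg hr0 i, ← ENNReal.ofReal_natCast,
      ← ENNReal.ofReal_mul' hn0.le]
    exact ENNReal.ofReal_le_ofReal (le_sum_pow_of_le hn (by linarith))
  have he : 0 < 1 - 1 / Real.exp 1 := by
    rw [sub_pos, div_lt_one (Real.exp_pos _)]
    exact Real.one_lt_exp_iff.2 one_pos
  have hsum0 : ∑ i : Fin n, ENNReal.ofReal (1 - p * F.law.real (Set.Ici τ)) ^ (i : ℕ) ≠ 0 := by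
    refine (lt_of_lt_of_le (ENNReal.mul_pos ?_ ?_) hsum).ne'
    · simpa using he
    · simpa using (by omega : n ≠ 0)
  have hsumt : ∑ i : Fin n, ENNReal.ofReal (1 - p * F.law.real (Set.Ici τ)) ^ (i : ℕ) ≠ ⊤ :=
    ENNReal.sum_ne_top.2 fun i _ => ENNReal.pow_ne_top ENNReal.ofReal_ne_top
  have hc : ENNReal.ofReal (meanWeight p ζ) ≠ 0 := by simpa using meanWeight_pos hp1 ζ
  rw [ENNReal.le_div_iff_mul_le, algValue_eq]
  · calc ENNReal.ofReal (1 - 1 / Real.exp 1) * optValue p ζ n F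
        ≤ ENNReal.ofReal (1 - 1 / Real.exp 1) * (ENNReal.ofReal (meanWeight p ζ) *
          (n * ∫⁻ x in Set.Ici τ, ENNReal.ofReal x ∂F.law)) := by
          gcongr
          exact optValue_le_of_quantile hp0 ζ hn F hτ
      _ = ENNReal.ofReal (meanWeight p ζ) * (ENNReal.ofReal (1 - 1 / Real.exp 1) * n) *
          ∫⁻ x in Set.Ici τ, ENNReal.ofReal x ∂F.law := by ring
      _ ≤ _ := by gcongr
  -- Excludes the degenerate quotients 0/0 and ⊤/⊤ by showing that the threshold value is positive
  -- and finite; p < 1 enters through `meanWeight_pos`.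
  · right
    rw [algValue_eq]
    exact mul_ne_zero (mul_ne_zero hc hsum0) (F.setLIntegral_ne_zero hq0)
  · right
    rw [algValue_eq]
    exact ENNReal.mul_ne_top (ENNReal.mul_ne_top ENNReal.ofReal_ne_top hsumt)
      (F.setLIntegral_ne_top τ)

/-! ### Scalar inequalities for the hard instance -/

open Real in
-- The second derivative is e^(s-1)(s - (e - 2)). On [e - 2, ∞) the function is convex with a double
-- zero at 1, hence nonnegative; on [0, e - 2] it is concave with nonnegative endpoint values.
theorem exp_mul_sub_add_nonneg {s : ℝ} (hs : 0 ≤ s) :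
    0 ≤ exp s * (s / exp 1 - 1) + 1 + (exp 1 - 2) * s := by
  set h : ℝ → ℝ := fun s => exp s * (s / exp 1 - 1) + 1 + (exp 1 - 2) * s with hh
  set h' : ℝ → ℝ := fun s => exp s * (s / exp 1 - 1 + 1 / exp 1) + (exp 1 - 2) with hh'
  set h'' : ℝ → ℝ := fun s => exp s * (s / exp 1 - 1 + 2 / exp 1) with hh''
  have he := exp_one_gt_d9
  have he' := exp_one_lt_d9
  have hd : ∀ s, HasDerivAt h (h' s) s := fun s => by
    have := (((hasDerivAt_exp s).mul (((hasDerivAt_id s).div_const (exp 1)).sub_const 1)).add_const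
      1).add ((hasDerivAt_id s).const_mul (exp 1 - 2))
    convert! this using 1
    simp only [hh', id]
    ring
  have hd' : ∀ s, HasDerivAt h' (h'' s) s := fun s => by
    have := ((hasDerivAt_exp s).mul ((((hasDerivAt_id s).div_const (exp 1)).sub_const 1).add_const
      (1 / exp 1))).add_const (exp 1 - 2)
    convert! this using 1
    simp only [hh'', id]
    ring
  have hc : Continuous h := continuous_iff_continuousAt.2 fun s => (hd s).continuousAt
  have hderiv : deriv h = h' := funext fun s => (hd s).deriv
  have hderiv2 : deriv^[2] h = h'' := by
    rw [Function.iterate_succ, Function.iterate_one, Function.comp, hderiv]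
    exact funext fun s => (hd' s).deriv
  have hsign : ∀ s, h'' s = exp s / exp 1 * (s - (exp 1 - 2)) := fun s => by
    simp only [hh'']
    field_simp
    ring
  have h0 : h 0 = 0 := by simp [hh]
  have h1 : h 1 = 0 := by
    simp only [hh]
    field_simp
    ring
  have h1' : h' 1 = 0 := by
    simp only [hh']
    field_simp
    ring
  have hconv : ConvexOn ℝ (Set.Ici (exp 1 - 2)) h := by
    refine convexOn_of_deriv2_nonneg (convex_Ici _) hc.continuousOn
      (fun s _ => (hd s).differentiableAt.differentiableWithinAt) ?_ ?_
    · rw [hderiv]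
      exact fun s _ => (hd' s).differentiableAt.differentiableWithinAt
    · intro s hs
      rw [interior_Ici, Set.mem_Ioi] at hs
      rw [hderiv2, hsign]
      have : 0 ≤ s - (exp 1 - 2) := by linarith
      positivity
  have hconc : ConcaveOn ℝ (Set.Icc 0 (exp 1 - 2)) h := by
    refine concaveOn_of_deriv2_nonpos (convex_Icc _ _) hc.continuousOn
      (fun s _ => (hd s).differentiableAt.differentiableWithinAt) ?_ ?_
    · rw [hderiv]
      exact fun s _ => (hd' s).differentiableAt.differentiableWithinAt
    · intro s hs
      rw [interior_Icc] at hs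
      rw [hderiv2, hsign]
      exact mul_nonpos_of_nonneg_of_nonpos (by positivity) (by linarith [hs.2])
  have hright : ∀ s, exp 1 - 2 ≤ s → 0 ≤ h s := by
    have hmem : (1 : ℝ) ∈ Set.Ici (exp 1 - 2) := by rw [Set.mem_Ici]; linarith
    intro s hs
    rcases lt_trichotomy s 1 with hlt | rfl | hlt
    · have := hconv.slope_le_of_hasDerivAt hs hmem hlt (hd 1)
      rw [h1', slope_def_field, h1, div_le_iff₀ (by linarith)] at this
      linarith
    · exact h1.ge
    · have := hconv.le_slope_of_hasDerivAt hmem hs hlt (hd 1)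
      rw [h1', slope_def_field, h1, le_div_iff₀ (by linarith)] at this
      linarith
  rcases le_total s (exp 1 - 2) with hs' | hs'
  · have hpos : 0 ≤ h (exp 1 - 2) := hright _ le_rfl
    have := hconc.min_le_of_mem_Icc (x := 0) (y := exp 1 - 2) (z := s) (by simp; linarith)
      (by simp; linarith) ⟨hs, hs'⟩
    rw [h0, min_eq_left hpos] at this
    exact this
  · exact hright s hs'

open Real in
-- Equality holds at t = 1: e - 2 is the constant for which the derivative of the left side vanishes
-- there.
theorem one_sub_exp_neg_mul_le {t : ℝ} (ht : 0 < t) :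
    (1 - exp (-t)) * ((exp 1 - 2) + 1 / t) ≤ exp 1 - 2 + 1 / exp 1 := by
  have h := exp_mul_sub_add_nonneg ht.le
  have h1 : exp 1 - 2 + 1 / exp 1 - (1 - exp (-t)) * ((exp 1 - 2) + 1 / t) =
      exp (-t) / t * (exp t * (t / exp 1 - 1) + 1 + (exp 1 - 2) * t) := by
    rw [exp_neg]
    field_simp
    ring
  rw [← sub_nonneg, h1]
  positivity

open Real in
-- With x = t/n, 1 + x ≤ e^x gives 1 - x² ≤ (1 - x)e^x; raise to the power n and apply Bernoulli.
theorem exp_neg_mul_le_one_sub_div_pow {n : ℕ} (hn : 1 ≤ n) {t : ℝ} (ht : 0 ≤ t) (htn : t ≤ n) :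
    exp (-t) * (1 - t ^ 2 / n) ≤ (1 - t / n) ^ n := by
  have hn0 : (0 : ℝ) < n := by exact_mod_cast hn
  set x := t / n with hx
  have hx0 : 0 ≤ x := by positivity
  have hx1 : x ≤ 1 := by rw [hx, div_le_one hn0]; exact htn
  have h1 : 1 - x ^ 2 ≤ (1 - x) * exp x := by
    have := add_one_le_exp x
    nlinarith
  have h2 : 1 - t ^ 2 / n ≤ (1 - x ^ 2) ^ n := by
    have := one_add_mul_le_pow (a := -x ^ 2) (by nlinarith) n
    have hx2 : (n : ℝ) * -x ^ 2 = - (t ^ 2 / n) := by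
      rw [hx]; field_simp
    rw [hx2] at this
    simpa [sub_eq_add_neg] using this
  have h3 : (1 - x ^ 2) ^ n ≤ (1 - x) ^ n * exp t := by
    have h4 : exp t = exp x ^ n := by
      rw [← exp_nat_mul, hx]; congr 1; field_simp
    rw [h4, ← mul_pow]
    exact pow_le_pow_left₀ (by nlinarith) h1 n
  calc exp (-t) * (1 - t ^ 2 / n) ≤ exp (-t) * ((1 - x) ^ n * exp t) := by
        gcongr; exact h2.trans h3
    _ = (1 - x) ^ n := by rw [exp_neg]; field_simp

open Real in
-- Finite-n form of the preceding maximum. Replacing (1 - t/n)^n by e^(-t) costs at most 2/n, and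
-- replacing t^(1/n - 1) by 1/t costs at most 1/n, uniformly in t.
theorem one_sub_pow_mul_le {n : ℕ} (hn : 1 ≤ n) {t : ℝ} (ht : 0 < t) (htn : t ≤ n) :
    (1 - (1 - t / n) ^ n) * ((exp 1 - 2) + t ^ ((1 : ℝ) / n - 1)) ≤
      exp 1 - 2 + 1 / exp 1 + 3 / n := by
  have hn0 : (0 : ℝ) < n := by exact_mod_cast hn
  have hn1 : (1 : ℝ) ≤ n := by exact_mod_cast hn
  have he := exp_one_gt_d9
  have he' := exp_one_lt_d9
  set ε : ℝ := 1 / n with hε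
  have hε0 : 0 ≤ ε := by positivity
  have hε1 : ε ≤ 1 := by rw [hε, div_le_one hn0]; exact hn1
  have hpow : t ^ (ε - 1) = t ^ ε / t := rpow_sub_one ht.ne' ε
  have hsq : t ^ 2 ≤ exp t := by
    have h3 : 1 + t / 2 + (t / 2) ^ 2 / 2 ≤ exp (t / 2) := quadratic_le_exp_of_nonneg (by positivity)
    have h4 : exp t = exp (t / 2) ^ 2 := by rw [← exp_nat_mul]; congr 1; push_cast; ring
    rw [h4]
    refine pow_le_pow_left₀ ht.le ?_ 2
    nlinarith [sq_nonneg (t / 2 - 1)]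
  have hle : t ^ ε / t ≤ 1 / t + ε := by
    have : t ^ ε ≤ 1 + ε * (t - 1) := by
      have := rpow_one_add_le_one_add_mul_self (s := t - 1) (by linarith) hε0 hε1
      simpa using this
    rw [div_le_iff₀ ht, add_mul, one_div, inv_mul_cancel₀ ht.ne']
    linarith
  have hE : t ^ 2 * exp (-t) * (t ^ ε / t) ≤ 1 := by
    rw [exp_neg, ← div_eq_mul_inv, div_mul_eq_mul_div, div_le_one (exp_pos t)]
    have h5 : t ^ 2 * (t ^ ε / t) = t * t ^ ε := by field_simp
    rw [h5]
    rcases le_total t 1 with h | h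
    · have := rpow_le_one ht.le h hε0
      have := add_one_le_exp t
      nlinarith
    · have : t ^ ε ≤ t ^ (1 : ℝ) := rpow_le_rpow_of_exponent_le h hε1
      rw [rpow_one] at this
      nlinarith
  have hE' : t ^ 2 * exp (-t) ≤ 1 := by
    rw [exp_neg, ← div_eq_mul_inv, div_le_one (exp_pos t)]
    exact hsq
  have h1 : 1 - (1 - t / n) ^ n ≤ 1 - exp (-t) + t ^ 2 * exp (-t) / n := by
    have := exp_neg_mul_le_one_sub_div_pow hn ht.le htn
    have h6 : exp (-t) * (1 - t ^ 2 / n) = exp (-t) - t ^ 2 * exp (-t) / n := by ring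
    linarith
  have hnn : 0 ≤ t ^ ε / t := by positivity
  have h2 := one_sub_exp_neg_mul_le ht
  have h0 : 0 ≤ 1 - exp (-t) := by
    rw [sub_nonneg, exp_le_one_iff]; linarith
  rw [hpow]
  calc (1 - (1 - t / n) ^ n) * ((exp 1 - 2) + t ^ ε / t)
      ≤ (1 - exp (-t) + t ^ 2 * exp (-t) / n) * ((exp 1 - 2) + t ^ ε / t) :=
        mul_le_mul_of_nonneg_right h1 (by linarith)
    _ = (1 - exp (-t)) * ((exp 1 - 2) + t ^ ε / t) +
        (t ^ 2 * exp (-t) * (exp 1 - 2) + t ^ 2 * exp (-t) * (t ^ ε / t)) / n := by ring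
    _ ≤ (1 - exp (-t)) * ((exp 1 - 2) + (1 / t + ε)) + (1 * 1 + 1) / n := by
        have : exp 1 - 2 ≤ 1 := by linarith
        have : 0 ≤ exp 1 - 2 := by linarith
        gcongr
    _ = (1 - exp (-t)) * ((exp 1 - 2) + 1 / t) + ε * (1 - exp (-t)) + 2 / n := by ring
    _ ≤ (exp 1 - 2 + 1 / exp 1) + ε * 1 + 2 / n := by
        have : 1 - exp (-t) ≤ 1 := by linarith [exp_pos (-t)]
        gcongr
    _ = exp 1 - 2 + 1 / exp 1 + 3 / n := by rw [hε]; ring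

/-! ### Power laws defined by their quantile function -/

theorem continuous_cdf_of_noAtoms (μ : Measure ℝ) [IsProbabilityMeasure μ]
    (h : ∀ x, μ {x} = 0) : Continuous (cdf μ) := by
  refine continuous_iff_continuousAt.2 fun x => ?_
  rw [(cdf μ).mono.continuousAt_iff_leftLim_eq_rightLim, StieltjesFunction.rightLim_eq]
  refine le_antisymm ((cdf μ).mono.leftLim_le le_rfl) ?_
  have := h x
  rw [← measure_cdf μ, StieltjesFunction.measure_singleton, ENNReal.ofReal_eq_zero] at this
  linarith

/-- Quantile function (in the upper tail probability) of a shifted power law. -/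
noncomputable def powerQuantile (a b ε u : ℝ) : ℝ := b + a * ε * u ^ (ε - 1)

section PowerLaw

variable {a b ε : ℝ}

theorem measurable_powerQuantile : Measurable (powerQuantile a b ε) := by
  unfold powerQuantile
  fun_prop

theorem powerQuantile_strictAntiOn (ha : 0 < a) (hε0 : 0 < ε) (hε1 : ε < 1) :
    StrictAntiOn (powerQuantile a b ε) (Set.Ioi 0) := by
  intro u hu v _ huv
  have := Real.rpow_lt_rpow_of_neg hu huv (sub_neg.2 hε1)
  have : 0 < a * ε := by positivity
  unfold powerQuantile
  gcongr

theorem powerQuantile_continuousOn : ContinuousOn (powerQuantile a b ε) (Set.Ioi 0) := by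
  intro u hu
  refine ContinuousAt.continuousWithinAt ?_
  unfold powerQuantile
  have := Real.continuousAt_rpow_const u (ε - 1) (Or.inl (ne_of_gt hu))
  fun_prop

theorem le_powerQuantile (ha : 0 < a) (hε0 : 0 < ε) {u : ℝ} (hu : 0 < u) :
    b ≤ powerQuantile a b ε u := by
  unfold powerQuantile
  have : 0 ≤ a * ε * u ^ (ε - 1) := by positivity
  linarith

theorem intervalIntegrable_powerQuantile (hε0 : 0 < ε) (q : ℝ) :
    IntervalIntegrable (powerQuantile a b ε) volume 0 q :=
  intervalIntegrable_const.add
    ((intervalIntegral.intervalIntegrable_rpow' (by linarith)).const_mul _)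

theorem setLIntegral_powerQuantile (ha : 0 < a) (hb : 0 ≤ b) (hε0 : 0 < ε) {q : ℝ} (hq : 0 ≤ q) :
    ∫⁻ u in Set.Ioc 0 q, ENNReal.ofReal (powerQuantile a b ε u) =
      ENNReal.ofReal (b * q + a * q ^ ε) := by
  have hi := intervalIntegrable_powerQuantile (a := a) (b := b) hε0 q
  rw [← ofReal_integral_eq_lintegral_ofReal
    ((intervalIntegrable_iff_integrableOn_Ioc_of_le hq).1 hi), ← intervalIntegral.integral_of_le hq]
  · congr 1
    unfold powerQuantile
    rw [intervalIntegral.integral_add intervalIntegrable_const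
      ((intervalIntegral.intervalIntegrable_rpow' (by linarith)).const_mul _),
      intervalIntegral.integral_const_mul, integral_rpow (Or.inl (by linarith)),
      intervalIntegral.integral_const]
    simp only [sub_add_cancel, Real.zero_rpow hε0.ne', smul_eq_mul]
    field_simp
    ring
  · refine (ae_restrict_iff' measurableSet_Ioc).2 (Filter.Eventually.of_forall fun u hu => ?_)
    exact hb.trans (le_powerQuantile ha hε0 hu.1)

/-- Push-forward of the uniform law on `(0, 1]` under the power quantile function. -/
noncomputable def powerMeasure (a b ε : ℝ) : Measure ℝ :=
  (volume.restrict (Set.Ioc 0 1)).map (powerQuantile a b ε)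

instance isProbabilityMeasure_powerMeasure : IsProbabilityMeasure (powerMeasure a b ε) := by
  have : IsProbabilityMeasure (volume.restrict (Set.Ioc (0 : ℝ) 1)) := ⟨by simp⟩
  exact Measure.isProbabilityMeasure_map measurable_powerQuantile.aemeasurable

theorem powerMeasure_apply {s : Set ℝ} (hs : MeasurableSet s) :
    powerMeasure a b ε s = volume (powerQuantile a b ε ⁻¹' s ∩ Set.Ioc 0 1) := by
  rw [powerMeasure, Measure.map_apply measurable_powerQuantile hs,
    Measure.restrict_apply (measurable_powerQuantile hs)]

theorem powerMeasure_singleton (ha : 0 < a) (hε0 : 0 < ε) (hε1 : ε < 1) (x : ℝ) :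
    powerMeasure a b ε {x} = 0 := by
  rw [powerMeasure_apply (measurableSet_singleton x)]
  refine Set.Subsingleton.measure_zero (fun u hu v hv => ?_) _
  exact (powerQuantile_strictAntiOn (b := b) ha hε0 hε1).injOn hu.2.1 hv.2.1
    ((Set.mem_singleton_iff.1 hu.1).trans (Set.mem_singleton_iff.1 hv.1).symm)

theorem ae_powerMeasure_ge (ha : 0 < a) (hε0 : 0 < ε) : ∀ᵐ x ∂powerMeasure a b ε, b ≤ x := by
  rw [ae_iff, powerMeasure_apply (by simp only [not_le]; exact measurableSet_Iio)]
  convert measure_empty (μ := (volume : Measure ℝ))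
  refine Set.eq_empty_of_forall_notMem fun u hu => hu.1 ?_
  exact le_powerQuantile ha hε0 hu.2.1

theorem strictMonoOn_cdf_powerMeasure (ha : 0 < a) (hε0 : 0 < ε) (hε1 : ε < 1) :
    StrictMonoOn (cdf (powerMeasure a b ε))
      {x | 0 < cdf (powerMeasure a b ε) x ∧ cdf (powerMeasure a b ε) x < 1} := by
  intro x hx y hy hxy
  have hanti := powerQuantile_strictAntiOn (b := b) ha hε0 hε1
  obtain ⟨u₁, hu₁, hu₁'⟩ : ∃ u, powerQuantile a b ε u ≤ x ∧ u ∈ Set.Ioc (0 : ℝ) 1 := by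
    have h := hx.1
    by_contra! hne
    rw [cdf_eq_real, measureReal_def, powerMeasure_apply measurableSet_Iic] at h
    have : powerQuantile a b ε ⁻¹' Set.Iic x ∩ Set.Ioc 0 1 = ∅ :=
      Set.eq_empty_of_forall_notMem fun u hu => hne u hu.1 hu.2
    simp [this] at h
  obtain ⟨u₂, hu₂, hu₂'⟩ : ∃ u, y < powerQuantile a b ε u ∧ u ∈ Set.Ioc (0 : ℝ) 1 := by
    have h := hy.2
    by_contra! hne
    rw [cdf_eq_real, measureReal_def, powerMeasure_apply measurableSet_Iic] at h
    have : powerQuantile a b ε ⁻¹' Set.Iic y ∩ Set.Ioc 0 1 = Set.Ioc 0 1 :=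
      Set.inter_eq_right.2 fun u hu => not_lt.1 fun hlt => hne u hlt hu
    simp [this] at h
  have hlt : u₂ < u₁ := by
    rw [← hanti.lt_iff_gt hu₁'.1 hu₂'.1]
    linarith
  -- The quantile function crosses (x + y)/2 between u₂ and u₁, so an open nonempty set of u is sent
  -- into (x, y), which therefore has positive mass.
  have hsub : Set.Ioo u₂ u₁ ⊆ Set.Ioi 0 := fun u hu => hu₂'.1.trans hu.1
  have hcont : ContinuousOn (powerQuantile a b ε) (Set.Icc u₂ u₁) :=
    powerQuantile_continuousOn.mono fun u hu => hu₂'.1.trans_le hu.1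
  obtain ⟨z, hz, hz'⟩ := intermediate_value_Ioo' hlt.le hcont
    (show (x + y) / 2 ∈ Set.Ioo _ _ from ⟨by linarith, by linarith⟩)
  have hopen : IsOpen (Set.Ioo u₂ u₁ ∩ powerQuantile a b ε ⁻¹' Set.Ioo x y) :=
    (powerQuantile_continuousOn.mono hsub).isOpen_inter_preimage isOpen_Ioo isOpen_Ioo
  have hpos := hopen.measure_pos volume
    ⟨z, hz, by rw [Set.mem_preimage, hz']; constructor <;> linarith⟩
  have hle : volume (Set.Ioo u₂ u₁ ∩ powerQuantile a b ε ⁻¹' Set.Ioo x y) ≤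
      powerMeasure a b ε (Set.Ioc x y) := by
    rw [powerMeasure_apply measurableSet_Ioc]
    refine measure_mono fun u hu => ⟨Set.Ioo_subset_Ioc_self hu.2, ?_⟩
    exact ⟨hsub hu.1, hu.1.2.le.trans hu₁'.2⟩
  have h := hpos.trans_le hle
  rw [← measure_cdf (powerMeasure a b ε), StieltjesFunction.measure_Ioc, ENNReal.ofReal_pos] at h
  linarith

/-- The shifted power law, as a value law. -/
noncomputable def powerLaw (a b ε : ℝ) (ha : 0 < a) (hb : 0 ≤ b) (hε0 : 0 < ε) (hε1 : ε < 1) :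
    ValueLaw where
  law := powerMeasure a b ε
  isProbabilityMeasure := inferInstance
  nonneg := by
    have := ae_powerMeasure_ge (b := b) ha hε0
    rw [ae_iff] at this
    refine measure_mono_null (fun x hx => ?_) this
    exact not_le.2 (lt_of_lt_of_le hx hb)
  continuous_cdf := continuous_cdf_of_noAtoms _ (powerMeasure_singleton ha hε0 hε1)
  strictMonoOn_cdf := strictMonoOn_cdf_powerMeasure ha hε0 hε1
  integrable := by
    rw [powerMeasure, integrable_map_measure (by fun_prop) measurable_powerQuantile.aemeasurable]
    exact (intervalIntegrable_iff_integrableOn_Ioc_of_le zero_le_one).1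
      (intervalIntegrable_powerQuantile hε0 1)

theorem setLIntegral_powerMeasure {s : Set ℝ} (hs : MeasurableSet s) {f : ℝ → ℝ≥0∞}
    (hf : Measurable f) : ∫⁻ x in s, f x ∂powerMeasure a b ε =
      ∫⁻ u in powerQuantile a b ε ⁻¹' s ∩ Set.Ioc 0 1, f (powerQuantile a b ε u) := by
  rw [powerMeasure, setLIntegral_map hs hf measurable_powerQuantile,
    Measure.restrict_restrict (measurable_powerQuantile hs)]

/-- As the quantile function decreases, the preimage of a tail is an initial interval of (0, 1]
whose length is the tail mass q, so it lies in (0, q]. -/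
theorem setLIntegral_Ici_powerMeasure_le (ha : 0 < a) (hb : 0 ≤ b) (hε0 : 0 < ε) (hε1 : ε < 1)
    (τ : ℝ) : ∫⁻ x in Set.Ici τ, ENNReal.ofReal x ∂powerMeasure a b ε ≤
      ENNReal.ofReal (b * (powerMeasure a b ε).real (Set.Ici τ) +
        a * (powerMeasure a b ε).real (Set.Ici τ) ^ ε) := by
  have hanti := powerQuantile_strictAntiOn (b := b) ha hε0 hε1
  rw [← setLIntegral_powerQuantile ha hb hε0 measureReal_nonneg,
    setLIntegral_powerMeasure measurableSet_Ici (by fun_prop)]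
  refine lintegral_mono_set fun u hu => ⟨hu.2.1, ?_⟩
  have hsub : Set.Ioc 0 u ⊆ powerQuantile a b ε ⁻¹' Set.Ici τ ∩ Set.Ioc 0 1 := fun v hv =>
    ⟨(show τ ≤ _ from hu.1).trans (hanti.antitoneOn hv.1 hu.2.1 hv.2), hv.1, hv.2.trans hu.2.2⟩
  have h := measure_mono (μ := volume) hsub
  rw [← powerMeasure_apply measurableSet_Ici, Real.volume_Ioc, sub_zero] at h
  exact (ENNReal.ofReal_le_iff_le_toReal (measure_ne_top _ _)).1 h

theorem preimage_Ici_powerQuantile (ha : 0 < a) (hε0 : 0 < ε) (hε1 : ε < 1) {δ : ℝ} (hδ0 : 0 < δ)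
    (hδ1 : δ ≤ 1) : powerQuantile a b ε ⁻¹' Set.Ici (powerQuantile a b ε δ) ∩ Set.Ioc 0 1 =
      Set.Ioc 0 δ := by
  have hanti := powerQuantile_strictAntiOn (b := b) ha hε0 hε1
  ext u
  constructor
  · rintro ⟨h, hu⟩
    exact ⟨hu.1, (hanti.le_iff_ge hδ0 hu.1).1 h⟩
  · rintro hu
    exact ⟨(hanti.le_iff_ge hδ0 hu.1).2 hu.2, hu.1, hu.2.trans hδ1⟩

theorem powerMeasure_Iio (ha : 0 < a) (hε0 : 0 < ε) (hε1 : ε < 1) {δ : ℝ} (hδ0 : 0 < δ)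
    (hδ1 : δ ≤ 1) : powerMeasure a b ε (Set.Iio (powerQuantile a b ε δ)) =
      ENNReal.ofReal (1 - δ) := by
  rw [← Set.compl_Ici, prob_compl_eq_one_sub measurableSet_Ici, powerMeasure_apply measurableSet_Ici,
    preimage_Ici_powerQuantile ha hε0 hε1 hδ0 hδ1, Real.volume_Ioc, sub_zero,
    ENNReal.ofReal_sub _ hδ0.le, ENNReal.ofReal_one]

theorem setLIntegral_Ici_sub_powerMeasure (ha : 0 < a) (hε0 : 0 < ε) (hε1 : ε < 1) {δ : ℝ}
    (hδ0 : 0 < δ) (hδ1 : δ ≤ 1) :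
    ∫⁻ x in Set.Ici (powerQuantile a b ε δ), ENNReal.ofReal (x - b) ∂powerMeasure a b ε =
      ENNReal.ofReal (a * δ ^ ε) := by
  rw [setLIntegral_powerMeasure measurableSet_Ici (by fun_prop),
    preimage_Ici_powerQuantile ha hε0 hε1 hδ0 hδ1]
  have h := setLIntegral_powerQuantile (b := 0) ha le_rfl hε0 hδ0.le
  simpa [powerQuantile] using h

end PowerLaw

/-! ### The hard instances -/

theorem sum_ofReal_pow {r : ℝ} (hr : 0 ≤ r) (n : ℕ) :
    ∑ i : Fin n, ENNReal.ofReal r ^ (i : ℕ) = ENNReal.ofReal (∑ i ∈ Finset.range n, r ^ i) := by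
  rw [Fin.sum_univ_eq_sum_range (fun i => ENNReal.ofReal r ^ i) n,
    ENNReal.ofReal_sum_of_nonneg fun i _ => pow_nonneg hr i]
  simp_rw [ENNReal.ofReal_pow hr]

theorem sum_one_sub_pow {x : ℝ} (hx : x ≠ 0) (n : ℕ) :
    ∑ i ∈ Finset.range n, (1 - x) ^ i = (1 - (1 - x) ^ n) / x := by
  rw [geom_sum_eq (by simpa using hx), ← neg_div_neg_eq]
  congr 1 <;> ring

/-- The hard instance for `n` values: as `n` grows, the number of values in the upper tail becomes
Poisson and the power part concentrates on a single huge value. -/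
noncomputable def hardLaw (p : unitInterval) (n : ℕ) (hp : 0 < p) (hn : 2 ≤ n) : ValueLaw :=
  powerLaw (((p : ℝ) * n) ^ ((1 : ℝ) / n - 1)) (Real.exp 1 - 2) (1 / n)
    (Real.rpow_pos_of_pos (mul_pos hp (by exact_mod_cast (by omega : 0 < n))) _)
    (by linarith [Real.exp_one_gt_d9]) (by positivity)
    (by rw [div_lt_one (by positivity)]; exact_mod_cast hn)

theorem algValue_hardLaw_le {p : unitInterval} (hp : 0 < p) (ζ : unitInterval) {n : ℕ}
    (hn : 2 ≤ n) (τ : ℝ) :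
    algValue p ζ n (hardLaw p n hp hn) τ ≤ ENNReal.ofReal (meanWeight p ζ / p) *
      ENNReal.ofReal (Real.exp 1 - 2 + 1 / Real.exp 1 + 3 / n) := by
  have hp' : (0 : ℝ) < p := hp
  have hn0 : (0 : ℝ) < n := by positivity
  have hb : 0 ≤ Real.exp 1 - 2 := by linarith [Real.exp_one_gt_d9]
  set ε : ℝ := 1 / n with hε
  have hε0 : 0 < ε := by positivity
  have hε1 : ε < 1 := by rw [hε, div_lt_one hn0]; exact_mod_cast hn
  set a : ℝ := ((p : ℝ) * n) ^ (ε - 1) with ha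
  have ha0 : 0 < a := by positivity
  set q := (hardLaw p n hp hn).law.real (Set.Ici τ) with hq
  have hq1 : q ≤ 1 := measureReal_le_one
  have hq0 : 0 ≤ q := measureReal_nonneg
  have hr0 : 0 ≤ 1 - (p : ℝ) * q := by
    have := mul_le_mul p.2.2 hq1 hq0 zero_le_one
    linarith
  have hR : ∫⁻ x in Set.Ici τ, ENNReal.ofReal x ∂(hardLaw p n hp hn).law ≤
      ENNReal.ofReal ((Real.exp 1 - 2) * q + a * q ^ ε) :=
    setLIntegral_Ici_powerMeasure_le ha0 hb hε0 hε1 τ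
  rw [algValue_eq, ← hq, sum_ofReal_pow hr0, mul_assoc]
  have hc := meanWeight_nonneg p ζ
  calc _ ≤ ENNReal.ofReal (meanWeight p ζ) *
        (ENNReal.ofReal (∑ i ∈ Finset.range n, (1 - (p : ℝ) * q) ^ i) *
          ENNReal.ofReal ((Real.exp 1 - 2) * q + a * q ^ ε)) := by gcongr
    _ = ENNReal.ofReal (meanWeight p ζ * ((∑ i ∈ Finset.range n, (1 - (p : ℝ) * q) ^ i) *
          ((Real.exp 1 - 2) * q + a * q ^ ε))) := by
        rw [ENNReal.ofReal_mul hc,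
          ENNReal.ofReal_mul (Finset.sum_nonneg fun i _ => pow_nonneg hr0 i)]
    _ ≤ ENNReal.ofReal (meanWeight p ζ / p * (Real.exp 1 - 2 + 1 / Real.exp 1 + 3 / n)) := by
        refine ENNReal.ofReal_le_ofReal ?_
        rw [div_mul_eq_mul_div, mul_div_assoc]
        refine mul_le_mul_of_nonneg_left ?_ hc
        rcases hq0.eq_or_lt with h0 | h0
        · rw [← h0, Real.zero_rpow hε0.ne']
          simp only [mul_zero, add_zero]
          have : 0 ≤ 1 / Real.exp 1 + 3 / n := by positivity
          exact div_nonneg (by linarith) hp'.le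
        · have ht : 0 < (p : ℝ) * n * q := by positivity
          have htn : (p : ℝ) * n * q ≤ n := by
            have := mul_le_mul p.2.2 hq1 hq0 zero_le_one
            nlinarith
          have h := one_sub_pow_mul_le (by omega : 1 ≤ n) ht htn
          have hx : (p : ℝ) * n * q / n = p * q := by field_simp
          -- The scale a is chosen so that the bound depends on q only through t = pnq.
          have hpow : a * q ^ ε = ((p : ℝ) * n * q) ^ (ε - 1) * q := by
            rw [Real.mul_rpow (by positivity) hq0, Real.rpow_sub_one h0.ne' ε, ha]
            field_simp
          rw [hx, ← hε] at h
          rw [sum_one_sub_pow (by positivity), hpow, le_div_iff₀ hp']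
          refine le_trans (le_of_eq ?_) h
          have hcancel : ∀ s w : ℝ, s / (p * q) * ((Real.exp 1 - 2) * q + w * q) * p =
              s * (Real.exp 1 - 2 + w) := fun s w => by field_simp
          exact hcancel _ _
    _ = _ := ENNReal.ofReal_mul (by positivity)

theorem le_optValue_hardLaw {p : unitInterval} (hp : 0 < p) (ζ : unitInterval) {n : ℕ}
    (hn : 2 ≤ n) (hpn : 1 ≤ (p : ℝ) * n) :
    ENNReal.ofReal (meanWeight p ζ / p) * ENNReal.ofReal ((Real.exp 1 - 2) * (1 - (1 - p) ^ n) +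
      (1 / (n : ℝ)) ^ ((1 : ℝ) / n) * (1 - 1 / (p * n))) ≤
        optValue p ζ n (hardLaw p n hp hn) := by
  have hp' : (0 : ℝ) < p := hp
  have hn0 : (0 : ℝ) < n := by positivity
  have hn1 : (1 : ℝ) ≤ n := by exact_mod_cast (by omega : 1 ≤ n)
  have hb : 0 ≤ Real.exp 1 - 2 := by linarith [Real.exp_one_gt_d9]
  have hp1 : (0 : ℝ) ≤ 1 - p := sub_nonneg.2 p.2.2
  set ε : ℝ := 1 / n with hε
  have hε0 : 0 < ε := by positivity
  have hε1 : ε < 1 := by rw [hε, div_lt_one hn0]; exact_mod_cast hn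
  set a : ℝ := ((p : ℝ) * n) ^ (ε - 1) with ha
  have ha0 : 0 < a := by positivity
  -- With tail mass δ = 1/(pn²), the mean number nδ of values in the tail tends to 0, yet δ^ε tends
  -- to 1, so the tail keeps asymptotically all of the power part.
  set δ : ℝ := ε / (p * n) with hδ
  have hδ0 : 0 < δ := by positivity
  have hδ1 : δ ≤ 1 := by
    rw [hδ, div_le_one (by positivity)]
    linarith
  refine le_trans ?_ (le_optValue hp ζ n (by omega) (hardLaw p n hp hn) (Real.exp 1 - 2)
    (powerQuantile a (Real.exp 1 - 2) ε δ) hb (ae_powerMeasure_ge ha0 hε0))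
  have h1 : ∫⁻ x in Set.Ici (powerQuantile a (Real.exp 1 - 2) ε δ),
      ENNReal.ofReal (x - (Real.exp 1 - 2)) ∂(hardLaw p n hp hn).law = ENNReal.ofReal (a * δ ^ ε) :=
    setLIntegral_Ici_sub_powerMeasure ha0 hε0 hε1 hδ0 hδ1
  have h2 : (hardLaw p n hp hn).law (Set.Iio (powerQuantile a (Real.exp 1 - 2) ε δ)) =
      ENNReal.ofReal (1 - δ) := powerMeasure_Iio ha0 hε0 hε1 hδ0 hδ1
  have hδ1' : 0 ≤ 1 - δ := sub_nonneg.2 hδ1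
  have hs : 0 ≤ ∑ i ∈ Finset.range n, (1 - (p : ℝ)) ^ i :=
    Finset.sum_nonneg fun i _ => pow_nonneg hp1 i
  rw [h1, h2, sum_ofReal_pow hp1, ← ENNReal.ofReal_natCast, ← ENNReal.ofReal_pow hδ1',
    ← ENNReal.ofReal_mul hb, ← ENNReal.ofReal_mul (p := a * δ ^ ε) (by positivity),
    ← ENNReal.ofReal_mul hn0.le,
    ← ENNReal.ofReal_add (mul_nonneg hb hs) (by positivity),
    ← ENNReal.ofReal_mul (meanWeight_nonneg p ζ),
    ← ENNReal.ofReal_mul (div_nonneg (meanWeight_nonneg p ζ) hp'.le)]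
  refine ENNReal.ofReal_le_ofReal ?_
  rw [div_mul_eq_mul_div, mul_div_assoc]
  refine mul_le_mul_of_nonneg_left ?_ (meanWeight_nonneg p ζ)
  have hpow : (n : ℝ) * (a * δ ^ ε) = ε ^ ε / p := by
    rw [hδ, Real.div_rpow hε0.le (by positivity), ha, Real.rpow_sub_one (by positivity)]
    field_simp
  have hbern : 1 - 1 / ((p : ℝ) * n) ≤ (1 - δ) ^ (n - 1) := by
    have h := one_add_mul_le_pow (a := -δ) (by linarith) n
    have h3 : (1 - δ) ^ n ≤ (1 - δ) ^ (n - 1) :=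
      pow_le_pow_of_le_one hδ1' (by linarith) (by omega)
    have h4 : (n : ℝ) * -δ = -(1 / (p * n)) := by
      rw [hδ, hε]
      field_simp
    rw [h4] at h
    have h5 : (1 : ℝ) + -δ = 1 - δ := by ring
    rw [h5] at h
    linarith
  rw [sum_one_sub_pow hp'.ne', ← mul_assoc, hpow, add_div, mul_div_assoc]
  gcongr _ + ?_
  rw [mul_div_right_comm]
  gcongr

theorem gammaNA_n_le {p : unitInterval} (hp0 : 0 < p) (hp1 : p < 1) (ζ : unitInterval) {n : ℕ}
    (hn : 2 ≤ n) (hpn : 1 < (p : ℝ) * n) :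
    gammaNA_n p ζ n ≤ ENNReal.ofReal ((Real.exp 1 - 2 + 1 / Real.exp 1 + 3 / n) /
      ((Real.exp 1 - 2) * (1 - (1 - p) ^ n) +
        (1 / (n : ℝ)) ^ ((1 : ℝ) / n) * (1 - 1 / (p * n)))) := by
  have hp' : (0 : ℝ) < p := hp0
  have hn0 : (0 : ℝ) < n := by positivity
  have hb : 0 ≤ Real.exp 1 - 2 := by linarith [Real.exp_one_gt_d9]
  have hpos : 0 < (Real.exp 1 - 2) * (1 - (1 - (p : ℝ)) ^ n) +
      (1 / (n : ℝ)) ^ ((1 : ℝ) / n) * (1 - 1 / (p * n)) := by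
    have h1 : 0 ≤ 1 - (1 - (p : ℝ)) ^ n :=
      sub_nonneg.2 (pow_le_one₀ (sub_nonneg.2 p.2.2) (by linarith))
    have h2 : 0 < 1 - 1 / ((p : ℝ) * n) := by
      rw [sub_pos, div_lt_one (by positivity)]
      exact hpn
    positivity
  have hc : ENNReal.ofReal (meanWeight p ζ / p) ≠ 0 := by
    simpa using div_pos (meanWeight_pos hp1 ζ) hp'
  refine iSup_le fun τ => (iInf_le _ (hardLaw p n hp0 hn)).trans ?_
  refine (ENNReal.div_le_div (algValue_hardLaw_le hp0 ζ hn _)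
    (le_optValue_hardLaw hp0 ζ hn hpn.le)).trans_eq ?_
  rw [ENNReal.mul_div_mul_left _ _ hc ENNReal.ofReal_ne_top, ENNReal.ofReal_div_of_pos hpos]

/-! ### Limit of the bounds and conclusion -/

theorem tendsto_gammaNA_n_bound {p : unitInterval} (hp0 : 0 < p) :
    Filter.Tendsto (fun n : ℕ => (Real.exp 1 - 2 + 1 / Real.exp 1 + 3 / n) /
      ((Real.exp 1 - 2) * (1 - (1 - (p : ℝ)) ^ n) +
        (1 / (n : ℝ)) ^ ((1 : ℝ) / n) * (1 - 1 / (p * n)))) Filter.atTop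
      (nhds (1 - 1 / Real.exp 1)) := by
  have hp' : (0 : ℝ) < p := hp0
  have hinv : Filter.Tendsto (fun n : ℕ => (n : ℝ)⁻¹) Filter.atTop (nhds 0) :=
    tendsto_inv_atTop_nhds_zero_nat
  have h3 : Filter.Tendsto (fun n : ℕ => (3 : ℝ) / n) Filter.atTop (nhds 0) := by
    simpa [div_eq_mul_inv] using hinv.const_mul 3
  have hpn : Filter.Tendsto (fun n : ℕ => 1 / ((p : ℝ) * n)) Filter.atTop (nhds 0) := by
    simpa [mul_comm] using hinv.const_mul (p : ℝ)⁻¹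
  have hpow : Filter.Tendsto (fun n : ℕ => (1 - (p : ℝ)) ^ n) Filter.atTop (nhds 0) :=
    tendsto_pow_atTop_nhds_zero_of_lt_one (sub_nonneg.2 p.2.2) (by linarith)
  have hroot : Filter.Tendsto (fun n : ℕ => (1 / (n : ℝ)) ^ ((1 : ℝ) / n)) Filter.atTop
      (nhds 1) := by
    have h := (tendsto_rpow_div.comp tendsto_natCast_atTop_atTop (α := ℕ)).inv₀ one_ne_zero
    rw [inv_one] at h
    refine h.congr fun n => ?_
    rw [one_div (n : ℝ), Real.inv_rpow (Nat.cast_nonneg n)]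
    simp
  have hlim := (h3.const_add (Real.exp 1 - 2 + 1 / Real.exp 1)).div
    (((hpow.const_sub 1).const_mul (Real.exp 1 - 2)).add (hroot.mul (hpn.const_sub 1)))
    (by have := Real.exp_one_gt_d9
        simp only [sub_zero, mul_one]
        linarith)
  suffices hval : 1 - 1 / Real.exp 1 = (Real.exp 1 - 2 + 1 / Real.exp 1 + 0) /
      ((Real.exp 1 - 2) * (1 - 0) + 1 * (1 - 0)) by
    rw [hval]
    exact hlim
  have h0 : Real.exp 1 - 1 ≠ 0 := by linarith [Real.exp_one_gt_d9]
  have h1 : (Real.exp 1 - 2) * (1 - 0) + 1 * (1 - 0) = Real.exp 1 - 1 := by ring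
  rw [h1]
  field_simp
  ring

theorem le_gammaNA {p : unitInterval} (hp0 : 0 < p) (hp1 : p < 1) (ζ : unitInterval) :
    ENNReal.ofReal (1 - 1 / Real.exp 1) ≤ gammaNA p ζ := by
  have h : ∀ (n : ℕ) (F : ValueLaw), ∃ τ, 1 ≤ n →
      1 - cdf F.law τ = min 1 (1 / ((p : ℝ) * n)) := by
    intro n F
    by_cases hn : 1 ≤ n
    · have hp' : (0 : ℝ) < p := hp0
      have hn0 : (0 : ℝ) < n := by exact_mod_cast hn
      obtain ⟨τ, hτ⟩ := F.exists_quantile (q := min 1 (1 / ((p : ℝ) * n))) (by positivity)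
        (min_le_left _ _)
      exact ⟨τ, fun _ => hτ⟩
    -- Arbitrary value: n = 0 does not enter the infimum.
    · exact ⟨0, fun h => absurd h hn⟩
  choose τ hτ using h
  exact le_iSup_of_le τ (le_iInf fun n => le_iInf fun hn => le_iInf fun F =>
    le_ratio_of_quantile hp0 hp1 ζ hn F (hτ n F hn))

theorem gammaNA_le_gammaNA_n (p ζ : unitInterval) {n : ℕ} (hn : 1 ≤ n) :
    gammaNA p ζ ≤ gammaNA_n p ζ n :=
  iSup_le fun τ => le_iSup_of_le (τ n) ((iInf_le _ n).trans (iInf_le _ hn))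

theorem tendsto_gammaNA_n {p : unitInterval} (hp0 : 0 < p) (hp1 : p < 1) (ζ : unitInterval) :
    Filter.Tendsto (fun n : ℕ => gammaNA_n p ζ n) Filter.atTop
      (nhds (ENNReal.ofReal (1 - 1 / Real.exp 1))) := by
  refine tendsto_of_tendsto_of_tendsto_of_le_of_le' tendsto_const_nhds
    (ENNReal.tendsto_ofReal (tendsto_gammaNA_n_bound hp0)) ?_ ?_
  · filter_upwards [Filter.eventually_ge_atTop 1] with n hn
    exact (le_gammaNA hp0 hp1 ζ).trans (gammaNA_le_gammaNA_n p ζ hn)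
  · have h : Filter.Tendsto (fun n : ℕ => (p : ℝ) * n) Filter.atTop Filter.atTop :=
      tendsto_natCast_atTop_atTop.const_mul_atTop hp0
    filter_upwards [Filter.eventually_ge_atTop 2, h.eventually_gt_atTop 1] with n hn hpn
    exact gammaNA_n_le hp0 hp1 ζ hn hpn

theorem iInf_gammaNA_n_le {p : unitInterval} (hp0 : 0 < p) (hp1 : p < 1) (ζ : unitInterval) :
    (⨅ (n : ℕ) (_ : 1 ≤ n), gammaNA_n p ζ n) ≤ ENNReal.ofReal (1 - 1 / Real.exp 1) := by
  refine ge_of_tendsto (tendsto_gammaNA_n hp0 hp1 ζ) ?_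
  filter_upwards [Filter.eventually_ge_atTop 1] with n hn
  exact iInf₂_le n hn

end OSUD

theorem theorem1 (p ζ : unitInterval) (hp0 : 0 < p) (hp1 : p < 1) :
    OSUD.gammaNA p ζ = ENNReal.ofReal (1 - 1 / Real.exp 1) ∧
    (⨅ (n : ℕ) (_ : 1 ≤ n), OSUD.gammaNA_n p ζ n) = ENNReal.ofReal (1 - 1 / Real.exp 1) ∧
    (∀ n : ℕ, 1 ≤ n → ∀ F : OSUD.ValueLaw,
      (∃ τ : ℝ, 1 - cdf F.law τ = min 1 (1 / ((p : ℝ) * n))) ∧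
      ∀ τ : ℝ, 1 - cdf F.law τ = min 1 (1 / ((p : ℝ) * n)) →
        ENNReal.ofReal (1 - 1 / Real.exp 1) ≤
          OSUD.algValue p ζ n F τ / OSUD.optValue p ζ n F) ∧
    Filter.Tendsto (fun n : ℕ => OSUD.gammaNA_n p ζ n) Filter.atTop
      (nhds (ENNReal.ofReal (1 - 1 / Real.exp 1))) := by
  have hle : OSUD.gammaNA p ζ ≤ ⨅ (n : ℕ) (_ : 1 ≤ n), OSUD.gammaNA_n p ζ n :=
    le_iInf₂ fun n hn => OSUD.gammaNA_le_gammaNA_n p ζ hn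
  have hlower := OSUD.le_gammaNA hp0 hp1 ζ
  have hupper := OSUD.iInf_gammaNA_n_le hp0 hp1 ζ
  refine ⟨le_antisymm (hle.trans hupper) hlower, le_antisymm hupper (hlower.trans hle),
    fun n hn F => ⟨F.exists_quantile ?_ (min_le_left _ _), fun τ hτ =>
      OSUD.le_ratio_of_quantile hp0 hp1 ζ hn F hτ⟩, OSUD.tendsto_gammaNA_n hp0 hp1 ζ⟩
  have hp' : (0 : ℝ) < p := hp0
  have hn0 : (0 : ℝ) < n := by exact_mod_cast hn
  positivity
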